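/- All groups are finite. A \emph{formation} is an isomorphism-closed class $\mathfrak F$ of groups such that $G/N\in\mathfrak F$ whenever $G\in\mathfrak F$ and $N\trianglelefteq G$, and $G/(M\cap N)\in\mathfrak F$ whenever $M,N\trianglelefteq G$ with $G/M,\,G/N\in\mathfrak F$. It is \emph{saturated} if $G/\Phi(G)\in\mathfrak F$ implies $G\in\mathfrak F$, where $\Phi(G)$ is the Frattini subgroup of $G$, and \emph{subgroup-closed} if every subgroup of a group in $\mathfrak F$ is in $\mathfrak F$. Let $\mathfrak U$ be the class of supersoluble groups, i.e. groups all of whose chief factors have prime order. Let $\mathcal D$ be the class of groups with an ordered Sylow tower of supersoluble type, i.e. groups $G$ such that, if $p_1>p_2>\dots>p_n$ are the prime divisors of $|G|$, there is a series $1=S_0\le S_1\le\dots\le S_n=G$ of normal subgroups of $G$ with $S_i/S_{i-1}$ isomorphic to a Sylow $p_i$-subgroup of $G$ for $i=1,\dots,n$. Subgroups $A,B$ of a group are \emph{mutually permutable} if $UB=BU$ for all $U\le A$ and $AV=VA$ for all $V\le B$. Subgroups $A,B$ of a group $G$ are \emph{msp-permutable} if $AB$ is a subgroup of $G$ and, for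 all primes $p\ne q$, every Sylow $p$-subgroup $P$ of $A$ and every Sylow $q$-subgroup $Q$ of $B$ are mutually permutable. \textbf{Theorem.} Let $\mathfrak F$ be a subgroup-closed saturated formation with $\mathfrak U\subseteq\mathfrak F\subseteq\mathcal D$. Let $G=G_1G_2$ be the product of msp-permutable subgroups $G_1$ and $G_2$. If $G_1,G_2\in\mathfrak F$, then $G\in\mathfrak F$. -/

import Mathlib

open scoped Pointwise

universe u

/-- A class of finite groups: a property of finite groups (in a fixed universe). Invariance under
isomorphism is required separately, see `IsFormation`. -/
abbrev FinGroupClass : Type (u + 1) := (G : Type u) → [Group G] → [Finite G] → Prop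

/-- A formation: an isomorphism-invariant class of finite groups closed under quotients and
such that `G ⧸ (M ⊓ N)` lies in it whenever `G ⧸ M` and `G ⧸ N` do. -/
structure IsFormation (F : FinGroupClass.{u}) : Prop where
  of_mulEquiv : ∀ (G H : Type u) [Group G] [Finite G] [Group H] [Finite H],
    (G ≃* H) → F G → F H
  quotient : ∀ (G : Type u) [Group G] [Finite G] (N : Subgroup G) [N.Normal],
    F G → F (G ⧸ N)
  quotient_inf : ∀ (G : Type u) [Group G] [Finite G] (M N : Subgroup G) [M.Normal] [N.Normal],
    F (G ⧸ M) → F (G ⧸ N) → F (G ⧸ (M ⊓ N))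

/-- `F` is saturated: `G ⧸ Φ(G) ∈ F` implies `G ∈ F`, where `Φ(G)` is the Frattini subgroup. -/
def IsSaturated (F : FinGroupClass.{u}) : Prop :=
  ∀ (G : Type u) [Group G] [Finite G], F (G ⧸ frattini G) → F G

/-- `F` is closed under taking subgroups. -/
def IsSubgroupClosed (F : FinGroupClass.{u}) : Prop :=
  ∀ (G : Type u) [Group G] [Finite G] (H : Subgroup G), F G → F H

/-- `H / K` is a chief factor of `G`: both are normal in `G`, `K < H`, and no normal subgroup of
`G` lies strictly between them. -/
structure IsChiefFactor {G : Type u} [Group G] (K H : Subgroup G) : Prop where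
  normal_bot : K.Normal
  normal_top : H.Normal
  lt : K < H
  eq_or_eq : ∀ L : Subgroup G, L.Normal → K ≤ L → L ≤ H → L = K ∨ L = H

/-- A finite group is supersoluble if all its chief factors have prime order. -/
def IsSupersoluble (G : Type u) [Group G] [Finite G] : Prop :=
  ∀ K H : Subgroup G, IsChiefFactor K H → (Nat.card (H ⧸ K.subgroupOf H)).Prime

/-- `G` has an ordered Sylow tower of supersoluble type: if `p₁ > p₂ > ⋯ > pₙ` are the prime
divisors of `|G|`, there is a series `1 = S₀ ≤ S₁ ≤ ⋯ ≤ Sₙ = G` of normal subgroups of `G` with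
`Sᵢ / Sᵢ₋₁` isomorphic to a Sylow `pᵢ`-subgroup of `G` for each `i`. -/
def HasOrderedSylowTower (G : Type u) [Group G] [Finite G] : Prop :=
  ∃ (n : ℕ) (p : Fin n → ℕ) (S : Fin (n + 1) → Subgroup G) (_ : ∀ i, (S i).Normal),
    StrictAnti p ∧ Set.range p = {q : ℕ | q.Prime ∧ q ∣ Nat.card G} ∧
    Monotone S ∧ S 0 = ⊥ ∧ S (Fin.last n) = ⊤ ∧
    ∀ i : Fin n, ∃ P : Sylow (p i) G,
      Nonempty ((S i.succ ⧸ (S i.castSucc).subgroupOf (S i.succ)) ≃* P)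

/-- `A` and `B` are mutually permutable: `UB = BU` for all `U ≤ A` and `AV = VA` for all
`V ≤ B`. -/
def MutuallyPermutable {G : Type u} [Group G] (A B : Subgroup G) : Prop :=
  (∀ U : Subgroup G, U ≤ A → (U : Set G) * (B : Set G) = (B : Set G) * (U : Set G)) ∧
  (∀ V : Subgroup G, V ≤ B → (A : Set G) * (V : Set G) = (V : Set G) * (A : Set G))

/-- `A` and `B` are msp-permutable: `AB` is a subgroup of `G`, and every Sylow `p`-subgroup of
`A` and every Sylow `q`-subgroup of `B`, for primes `p ≠ q`, are mutually permutable. -/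
structure MspPermutable {G : Type u} [Group G] (A B : Subgroup G) : Prop where
  mul_isSubgroup : ∃ H : Subgroup G, (H : Set G) = (A : Set G) * (B : Set G)
  mutuallyPermutable : ∀ p q : ℕ, p.Prime → q.Prime → p ≠ q →
    ∀ (P : Sylow p A) (Q : Sylow q B),
      MutuallyPermutable ((P : Subgroup A).map A.subtype) ((Q : Subgroup B).map B.subtype)

/-!
The proof is by induction on the order of `G`: msp-permutability passes to quotients, so all
proper quotients of `G` lie in the class `F`, and if `G` does not, then `Φ(G) = 1` and any two
nontrivial normal subgroups of `G` intersect nontrivially.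

Let `p` be the largest prime divisor of `|G|`. A `p`-group that permutes with all subgroups of a
`q`-group, `q < p`, is normalised by it (`IsPGroup.le_normalizer_of_permutes`). As the factors
have normal Sylow `p`-subgroups, these generate a normal Sylow `p`-subgroup `P` of `G`
(`MspPermutable.exists_normal_sylow`). In the situation above `P` is an elementary abelian minimal
normal subgroup with a complement (`Sylow.exists_complement_of_frattini_eq_bot`). Each factor
normalises all subgroups of the intersection of `P` with the other one
(`MspPermutable.le_normalizer`). So these intersections are normal in `G`, one of the factors,
say `B`, contains `P`, and the other one, `A`, acts on `P` by scalars.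

It remains to see that scalars may be adjoined to the action of `B`. The local definition of a
saturated formation would give this; here a direct construction replaces it. For a representation
`ρ` of a group `H` on a vector space `V` over `ZMod p` and a character `χ` of `H`, let `H` act on
the group of class two on `V × ZMod p × V` whose commutator pairing `V × ZMod p → V` is scalar
multiplication, through `ρ`, `χ` and `χ • ρ` on the three coordinates. The derived subgroup of the
class two group lies in the Frattini subgroup of the semidirect product, and modulo it the
semidirect product embeds into the product of `V ⋊ H` and a supersoluble group. So if `F` contains
`V ⋊ H`, it contains the subgroup `V ⋊ H` with the twisted action
(`IsSaturated.repSemidirect_twist`). Taking for `H` a fibre product of `B`, the complement of `P`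
and the group of scalars exhibits `G` as a quotient of such a twisted semidirect product
(`IsSaturated.of_scalar_factor`).
-/

/-! ### Subdirect products in a formation -/

section Formation

variable {F : FinGroupClass.{u}} {G X Y : Type u} [Group G] [Group X] [Finite X]
  [Group Y] [Finite Y]

theorem IsFormation.of_surjective [Finite G] (hF : IsFormation F) (f : G →* X)
    (hf : Function.Surjective f) (hG : F G) : F X :=
  hF.of_mulEquiv _ _ (QuotientGroup.quotientKerEquivOfSurjective f hf) (hF.quotient G f.ker hG)

theorem IsFormation.of_injective [Finite G] (hF : IsFormation F) (hS : IsSubgroupClosed F)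
    (f : G →* X) (hf : Function.Injective f) (hX : F X) : F G :=
  hF.of_mulEquiv _ _ (MonoidHom.ofInjective hf).symm (hS X f.range hX)

theorem IsFormation.quotient_ker (hF : IsFormation F) (hS : IsSubgroupClosed F) (f : G →* X)
    (hX : F X) : F (G ⧸ f.ker) :=
  hF.of_injective hS (QuotientGroup.kerLift f) (QuotientGroup.kerLift_injective f) hX

theorem IsFormation.quotient_mono [Finite G] (hF : IsFormation F) {M N : Subgroup G}
    [M.Normal] [N.Normal] (h : M ≤ N) (hM : F (G ⧸ M)) : F (G ⧸ N) :=
  hF.of_surjective (QuotientGroup.map M N (MonoidHom.id G) h)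
    (QuotientGroup.map_surjective_of_surjective _ _ _
      ((QuotientGroup.mk'_surjective N).comp Function.surjective_id) _) hM

theorem IsFormation.of_inf_le_bot [Finite G] (hF : IsFormation F) {M N : Subgroup G}
    [M.Normal] [N.Normal] (h : M ⊓ N ≤ ⊥) (hM : F (G ⧸ M)) (hN : F (G ⧸ N)) : F G :=
  hF.of_mulEquiv _ _ QuotientGroup.quotientBot
    (hF.quotient_mono (N := (⊥ : Subgroup G)) h (hF.quotient_inf G M N hM hN))

/-- A group that embeds into the product of two groups of a subgroup-closed formation, through
the two coordinate homomorphisms, lies in the formation. -/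
theorem IsFormation.of_injective_prod [Finite G] (hF : IsFormation F) (hS : IsSubgroupClosed F)
    (f : G →* X) (g : G →* Y) (h : ∀ x, f x = 1 → g x = 1 → x = 1) (hX : F X) (hY : F Y) :
    F G :=
  hF.of_inf_le_bot (M := f.ker) (N := g.ker) (fun x hx => h x hx.1 hx.2)
    (hF.quotient_ker hS f hX) (hF.quotient_ker hS g hY)

theorem IsFormation.prod (hF : IsFormation F) (hS : IsSubgroupClosed F) (hX : F X) (hY : F Y) :
    F (X × Y) :=
  hF.of_injective_prod hS (MonoidHom.fst X Y) (MonoidHom.snd X Y)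
    (fun _ h₁ h₂ => Prod.ext h₁ h₂) hX hY

end Formation

/-! ### Supersoluble groups -/

theorem isSupersoluble_of_subsingleton (G : Type u) [Group G] [Finite G] [Subsingleton G] :
    IsSupersoluble G := fun _ _ h => absurd h.lt (by simp [Subsingleton.elim _ (⊤ : Subgroup G)])

/-- A chief factor `H / K` that is centralised by `G` has prime order, as each of its subgroups
is the image of a normal subgroup of `G`. -/
theorem IsChiefFactor.card_prime_of_central {G : Type u} [Group G] [Finite G] {K H : Subgroup G}
    (h : IsChiefFactor K H) (hc : ∀ g : G, ∀ x ∈ H, g * x * g⁻¹ * x⁻¹ ∈ K) :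
    (Nat.card (H ⧸ K.subgroupOf H)).Prime := by
  have := h.normal_bot
  have := h.normal_top
  obtain ⟨x, hxH, hxK⟩ := SetLike.exists_of_lt h.lt
  -- any subgroup between `K` and `H` is normal
  have key : ∀ L : Subgroup G, K ≤ L → L ≤ H → L = K ∨ L = H := fun L hKL hLH =>
    h.eq_or_eq L ⟨fun n hn g => by
      have := L.mul_mem (hKL (hc g n (hLH hn))) hn
      simpa using this⟩ hKL hLH
  have hnt : Nontrivial (H ⧸ K.subgroupOf H) :=
    ⟨⟨((⟨x, hxH⟩ : H) : H ⧸ K.subgroupOf H), 1, fun e => hxK (by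
      rw [QuotientGroup.eq_one_iff] at e
      simpa [Subgroup.mem_subgroupOf] using e)⟩⟩
  have hS : ∀ S : Subgroup (H ⧸ K.subgroupOf H), S = ⊥ ∨ S = ⊤ := fun S => by
    set T := S.comap (QuotientGroup.mk' (K.subgroupOf H)) with hT
    have hS : S = T.map (QuotientGroup.mk' (K.subgroupOf H)) :=
      (Subgroup.map_comap_eq_self_of_surjective (QuotientGroup.mk'_surjective _) S).symm
    have hKT : K.subgroupOf H ≤ T := QuotientGroup.le_comap_mk' _ _
    have hTT : (T.map H.subtype).subgroupOf H = T :=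
      Subgroup.comap_map_eq_self_of_injective H.subtype_injective T
    rcases key (T.map H.subtype) (fun k hk => ⟨⟨k, h.lt.le hk⟩, hKT hk, rfl⟩)
      (Subgroup.map_subtype_le T) with e | e
    · left
      rw [hS, ← hTT, e, QuotientGroup.map_mk'_self]
    · right
      rw [hS, ← hTT, e, Subgroup.subgroupOf_self]
      exact Subgroup.map_top_of_surjective _ (QuotientGroup.mk'_surjective _)
  obtain ⟨q, hq, hqd⟩ := Nat.exists_prime_and_dvd
    (Finite.one_lt_card (α := H ⧸ K.subgroupOf H)).ne'
  have := Fact.mk hq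
  obtain ⟨y, hy⟩ := exists_prime_orderOf_dvd_card' q hqd
  rcases hS (Subgroup.zpowers y) with e | e
  · rw [Subgroup.zpowers_eq_bot] at e
    exact absurd hy (by rw [e, orderOf_one]; exact hq.one_lt.ne)
  · rwa [← Subgroup.card_top, ← e, Nat.card_zpowers, hy]

/-- A group with a normal subgroup of prime order and commutative quotient is supersoluble. -/
theorem isSupersoluble_of_commutator_le {G : Type u} [Group G] [Finite G] {p : ℕ}
    (hp : p.Prime) (N : Subgroup G) [N.Normal] (hN : Nat.card N = p)
    (hc : ∀ x y : G, x * y * x⁻¹ * y⁻¹ ∈ N) : IsSupersoluble G := by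
  intro K H h
  have := h.normal_bot
  have := h.normal_top
  rcases h.eq_or_eq (K ⊔ (N ⊓ H)) inferInstance le_sup_left
    (sup_le h.lt.le inf_le_right) with e | e
  · refine h.card_prime_of_central fun g x hx => ?_
    refine (sup_eq_left.1 e) ⟨hc g x, ?_⟩
    exact H.mul_mem (h.normal_top.conj_mem x hx g) (H.inv_mem hx)
  · have hsurj : Function.Surjective ((QuotientGroup.mk' (K.subgroupOf H)).comp
        (Subgroup.inclusion (inf_le_right : N ⊓ H ≤ H))) := by
      intro q
      obtain ⟨⟨x, hx⟩, rfl⟩ := QuotientGroup.mk'_surjective _ q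
      have hx' := hx
      rw [← e, Subgroup.mem_sup_of_normal_left] at hx'
      obtain ⟨k, hk, n, hn, rfl⟩ := hx'
      refine ⟨⟨n, hn⟩, ?_⟩
      refine (QuotientGroup.mk'_eq_mk' _).2 ⟨⟨n⁻¹ * k * n, ?_⟩, ?_, ?_⟩
      · exact h.lt.le (by simpa using h.normal_bot.conj_mem k hk n⁻¹)
      · simpa [Subgroup.mem_subgroupOf] using h.normal_bot.conj_mem k hk n⁻¹
      · ext
        simp [mul_assoc]
    have h1 : Nat.card (H ⧸ K.subgroupOf H) ∣ p :=
      (Subgroup.card_dvd_of_surjective _ hsurj).trans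
        (hN ▸ Subgroup.card_dvd_of_le inf_le_left)
    rcases (Nat.dvd_prime hp).1 h1 with h2 | h2
    · rw [← Subgroup.index_eq_card, Subgroup.index_eq_one, Subgroup.subgroupOf_eq_top] at h2
      exact absurd h.lt (not_lt_of_ge h2)
    · rwa [h2]

/-! ### The affine group of the line -/

/-- The group of affine maps `x ↦ a * x + b` of `ZMod p`, with `a` a unit, placed in an
arbitrary universe. -/
@[ext]
structure AffineLine (p : ℕ) : Type u where
  /-- the slope `a` -/
  unit : (ZMod p)ˣ
  /-- the translation part `b` -/
  trans : ZMod p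

namespace AffineLine

variable {p : ℕ}

instance : Mul (AffineLine.{u} p) := ⟨fun x y => ⟨x.unit * y.unit, x.unit * y.trans + x.trans⟩⟩
instance : One (AffineLine.{u} p) := ⟨⟨1, 0⟩⟩
instance : Inv (AffineLine.{u} p) := ⟨fun x => ⟨x.unit⁻¹, -(x.unit⁻¹ * x.trans)⟩⟩

@[simp] theorem unit_mul (x y : AffineLine.{u} p) : (x * y).unit = x.unit * y.unit := rfl
@[simp] theorem trans_mul (x y : AffineLine.{u} p) :
    (x * y).trans = x.unit * y.trans + x.trans := rfl
@[simp] theorem unit_one : (1 : AffineLine.{u} p).unit = 1 := rfl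
@[simp] theorem trans_one : (1 : AffineLine.{u} p).trans = 0 := rfl
@[simp] theorem unit_inv (x : AffineLine.{u} p) : x⁻¹.unit = x.unit⁻¹ := rfl
@[simp] theorem trans_inv (x : AffineLine.{u} p) : x⁻¹.trans = -(x.unit⁻¹ * x.trans) := rfl

instance : Group (AffineLine.{u} p) :=
  Group.ofLeftAxioms
    (fun x y z => by ext <;> simp [mul_assoc, mul_add, add_assoc])
    (fun x => by ext <;> simp)
    (fun x => by ext <;> simp)

/-- The slope, as a homomorphism. -/
def unitHom : AffineLine.{u} p →* (ZMod p)ˣ where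
  toFun := unit
  map_one' := rfl
  map_mul' _ _ := rfl

instance [NeZero p] : Finite (AffineLine.{u} p) :=
  Finite.of_injective (fun x => (x.unit, x.trans)) fun x y h => by
    simp only [Prod.mk.injEq] at h
    exact AffineLine.ext h.1 h.2

theorem isSupersoluble (hp : p.Prime) [NeZero p] : IsSupersoluble (AffineLine.{u} p) := by
  refine isSupersoluble_of_commutator_le hp unitHom.ker ?_ fun x y => ?_
  · have e : (unitHom.ker : Subgroup (AffineLine.{u} p)) ≃ ZMod p :=
      { toFun x := x.1.trans
        invFun w := ⟨⟨1, w⟩, rfl⟩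
        left_inv := fun ⟨x, hx⟩ => Subtype.ext (AffineLine.ext (Eq.symm hx) rfl)
        right_inv _ := rfl }
    rw [Nat.card_congr e, Nat.card_zmod]
  · rw [MonoidHom.mem_ker]
    simp only [map_mul, map_inv]
    rw [mul_comm (unitHom x)]
    simp

end AffineLine

/-! ### Affine groups of representations and their twists -/

section RepSemidirect

variable {k H V : Type*} [CommRing k] [Group H] [AddCommGroup V] [Module k V]

/-- The semidirect product `V ⋊ H` attached to a representation of `H` on `V`: the pair
`(v, h)` stands for the affine map `x ↦ ρ h x + v`. -/
@[ext]
structure RepSemidirect (ρ : Representation k H V) where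
  /-- the translation part -/
  vec : V
  /-- the linear part -/
  lin : H

namespace RepSemidirect

variable {ρ : Representation k H V}

instance : Mul (RepSemidirect ρ) := ⟨fun x y => ⟨ρ x.lin y.vec + x.vec, x.lin * y.lin⟩⟩
instance : One (RepSemidirect ρ) := ⟨⟨0, 1⟩⟩
instance : Inv (RepSemidirect ρ) := ⟨fun x => ⟨-ρ x.lin⁻¹ x.vec, x.lin⁻¹⟩⟩

@[simp] theorem lin_mul (x y : RepSemidirect ρ) : (x * y).lin = x.lin * y.lin := rfl
@[simp] theorem vec_mul (x y : RepSemidirect ρ) : (x * y).vec = ρ x.lin y.vec + x.vec := rfl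
@[simp] theorem lin_one : (1 : RepSemidirect ρ).lin = 1 := rfl
@[simp] theorem vec_one : (1 : RepSemidirect ρ).vec = 0 := rfl
@[simp] theorem lin_inv (x : RepSemidirect ρ) : x⁻¹.lin = x.lin⁻¹ := rfl
@[simp] theorem vec_inv (x : RepSemidirect ρ) : x⁻¹.vec = -ρ x.lin⁻¹ x.vec := rfl

instance : Group (RepSemidirect ρ) :=
  Group.ofLeftAxioms
    (fun x y z => by ext <;> simp [mul_assoc, add_assoc])
    (fun x => by ext <;> simp)
    (fun x => by ext <;> simp)

instance [Finite H] [Finite V] : Finite (RepSemidirect ρ) :=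
  Finite.of_injective (fun x => (x.vec, x.lin)) fun x y h => by
    simp only [Prod.mk.injEq] at h
    exact RepSemidirect.ext h.1 h.2

end RepSemidirect

/-- The twist of a representation by a linear character. -/
def Representation.twist (ρ : Representation k H V) (χ : H →* kˣ) : Representation k H V where
  toFun h := (χ h : k) • ρ h
  map_one' := by simp
  map_mul' x y := by
    ext v
    simp only [map_mul, Units.val_mul, LinearMap.smul_apply, Module.End.mul_apply, map_smul,
      mul_smul]
    rw [smul_comm]

@[simp]
theorem Representation.twist_apply (ρ : Representation k H V) (χ : H →* kˣ) (h : H) (v : V) :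
    ρ.twist χ h v = (χ h : k) • ρ h v := rfl

/-- The group of all maps
`(x, y) ↦ (ρ h x + v, χ h • ρ h y + w • ρ h x + t)` of `V × V`, for `h : H`, `w : k` and
`v t : V`. It is the semidirect product of `H` with a Heisenberg-type group of class two, whose
commutator pairing `V × k → V` is scalar multiplication. -/
@[ext]
structure HeisenbergExt (ρ : Representation k H V) (χ : H →* kˣ) where
  /-- the component in `H` -/
  lin : H
  /-- the coefficient of the transvection -/
  scal : k
  /-- the translation of the first coordinate -/
  vec : V
  /-- the translation of the second coordinate -/
  cen : V

namespace HeisenbergExt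

variable {ρ : Representation k H V} {χ : H →* kˣ}

instance : Mul (HeisenbergExt ρ χ) := ⟨fun x y =>
  ⟨x.lin * y.lin, χ x.lin * y.scal + x.scal, ρ x.lin y.vec + x.vec,
    (χ x.lin : k) • ρ x.lin y.cen + x.scal • ρ x.lin y.vec + x.cen⟩⟩
instance : One (HeisenbergExt ρ χ) := ⟨⟨1, 0, 0, 0⟩⟩
instance : Inv (HeisenbergExt ρ χ) := ⟨fun x =>
  ⟨x.lin⁻¹, -((χ x.lin⁻¹ : k) * x.scal), -ρ x.lin⁻¹ x.vec,
    -((χ x.lin⁻¹ : k) • ρ x.lin⁻¹ x.cen) + ((χ x.lin⁻¹ : k) * x.scal) • ρ x.lin⁻¹ x.vec⟩⟩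

@[simp] theorem lin_mul (x y : HeisenbergExt ρ χ) : (x * y).lin = x.lin * y.lin := rfl
@[simp] theorem scal_mul (x y : HeisenbergExt ρ χ) :
    (x * y).scal = χ x.lin * y.scal + x.scal := rfl
@[simp] theorem vec_mul (x y : HeisenbergExt ρ χ) :
    (x * y).vec = ρ x.lin y.vec + x.vec := rfl
@[simp] theorem cen_mul (x y : HeisenbergExt ρ χ) : (x * y).cen =
    (χ x.lin : k) • ρ x.lin y.cen + x.scal • ρ x.lin y.vec + x.cen := rfl
@[simp] theorem lin_one : (1 : HeisenbergExt ρ χ).lin = 1 := rfl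
@[simp] theorem scal_one : (1 : HeisenbergExt ρ χ).scal = 0 := rfl
@[simp] theorem vec_one : (1 : HeisenbergExt ρ χ).vec = 0 := rfl
@[simp] theorem cen_one : (1 : HeisenbergExt ρ χ).cen = 0 := rfl
@[simp] theorem lin_inv (x : HeisenbergExt ρ χ) : x⁻¹.lin = x.lin⁻¹ := rfl
@[simp] theorem scal_inv (x : HeisenbergExt ρ χ) :
    x⁻¹.scal = -((χ x.lin⁻¹ : k) * x.scal) := rfl
@[simp] theorem vec_inv (x : HeisenbergExt ρ χ) : x⁻¹.vec = -ρ x.lin⁻¹ x.vec := rfl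
@[simp] theorem cen_inv (x : HeisenbergExt ρ χ) : x⁻¹.cen =
    -((χ x.lin⁻¹ : k) • ρ x.lin⁻¹ x.cen) + ((χ x.lin⁻¹ : k) * x.scal) • ρ x.lin⁻¹ x.vec := rfl

instance : Group (HeisenbergExt ρ χ) :=
  Group.ofLeftAxioms
    (fun x y z => by
      ext
      · simp [mul_assoc]
      · simp; ring
      · simp [add_assoc]
      · simp only [cen_mul, vec_mul, scal_mul, lin_mul, map_mul, map_add, map_smul,
          Module.End.mul_apply, Units.val_mul]
        module)
    (fun x => by ext <;> simp)
    (fun x => by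
      ext
      · simp
      · simp
      · simp
      · simp
        abel)

instance [Finite H] [Finite V] [Finite k] : Finite (HeisenbergExt ρ χ) :=
  Finite.of_injective (fun x => (x.lin, x.scal, x.vec, x.cen)) fun x y h => by
    simp only [Prod.mk.injEq] at h
    exact HeisenbergExt.ext h.1 h.2.1 h.2.2.1 h.2.2.2

/-- The action on the first coordinate. -/
def toRepSemidirect : HeisenbergExt ρ χ →* RepSemidirect ρ where
  toFun x := ⟨x.vec, x.lin⟩
  map_one' := rfl
  map_mul' _ _ := rfl

/-- The subgroup `v = 0`, `w = 0` is the affine group of the twisted representation. -/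
def ofTwist : RepSemidirect (ρ.twist χ) →* HeisenbergExt ρ χ where
  toFun x := ⟨x.lin, 0, 0, x.vec⟩
  map_one' := rfl
  map_mul' x y := by ext <;> simp

theorem ofTwist_injective : Function.Injective (ofTwist (ρ := ρ) (χ := χ)) := fun _ _ h =>
  RepSemidirect.ext (congrArg cen h) (congrArg lin h)

/-- The subgroup of translations of the second coordinate consists of commutators
`[(v), (w)]`, and so it lies in every subgroup that supplements it: changing `(v)` and `(w)` by
such translations, which centralise both, does not change the commutator. Hence it is contained
in the Frattini subgroup. -/
theorem le_frattini (R : Subgroup (HeisenbergExt ρ χ)) [R.Normal]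
    (hR : ∀ x, x ∈ R ↔ x.lin = 1 ∧ x.scal = 0 ∧ x.vec = 0) :
    R ≤ frattini (HeisenbergExt ρ χ) := by
  refine le_iInf₂ fun M hM => ?_
  by_contra hRM
  have hsup : R ⊔ M = ⊤ := hM.2 _ (right_lt_sup.2 hRM)
  have key : ∀ x : HeisenbergExt ρ χ, ∃ r ∈ R, ∃ m ∈ M, r * m = x := fun x => by
    have : x ∈ R ⊔ M := hsup ▸ Subgroup.mem_top x
    rwa [Subgroup.mem_sup_of_normal_left] at this
  refine hRM fun x hx => ?_
  obtain ⟨hx1, hx2, hx3⟩ := (hR x).1 hx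
  obtain ⟨r, hr, a, ha, hra⟩ := key ⟨1, 1, 0, 0⟩
  obtain ⟨s, hs, b, hb, hsb⟩ := key ⟨1, 0, x.cen, 0⟩
  obtain ⟨hr1, hr2, hr3⟩ := (hR r).1 hr
  obtain ⟨hs1, hs2, hs3⟩ := (hR s).1 hs
  rw [HeisenbergExt.ext_iff] at hra hsb
  simp only [lin_mul, scal_mul, vec_mul, cen_mul, hr1, hr2, hr3, hs1, hs2, hs3, map_one, one_mul,
    Units.val_one, Module.End.one_apply, add_zero, zero_smul] at hra hsb
  obtain ⟨ha1, ha2, ha3, ha4⟩ := hra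
  obtain ⟨hb1, hb2, hb3, hb4⟩ := hsb
  have : x = a * b * (b * a)⁻¹ := by
    rw [eq_mul_inv_iff_mul_eq]
    ext <;> simp [*]
    abel
  rw [this]
  exact M.mul_mem (M.mul_mem ha hb) (M.inv_mem (M.mul_mem hb ha))

end HeisenbergExt

end RepSemidirect

/-- The action of `HeisenbergExt ρ χ` on the transvection coordinate. -/
def HeisenbergExt.toAffineLine {p : ℕ} {H V : Type*} [Group H] [AddCommGroup V]
    [Module (ZMod p) V] {ρ : Representation (ZMod p) H V} {χ : H →* (ZMod p)ˣ} :
    HeisenbergExt ρ χ →* AffineLine.{u} p where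
  toFun x := ⟨χ x.lin, x.scal⟩
  map_one' := AffineLine.ext (map_one χ) rfl
  map_mul' _ _ := AffineLine.ext (map_mul χ _ _) rfl

/-- A subgroup-closed saturated formation that contains the supersoluble groups and `V ⋊ H`
contains `V ⋊ H` with the action twisted by any linear character of `H`. The twisted group is a
subgroup of `HeisenbergExt ρ χ`, whose quotient by a subgroup of its Frattini subgroup embeds into
the product of `V ⋊ H` and a supersoluble group. -/
theorem IsSaturated.repSemidirect_twist {F : FinGroupClass.{u}} (hsat : IsSaturated F)
    (hF : IsFormation F) (hS : IsSubgroupClosed F)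
    (hU : ∀ (X : Type u) [Group X] [Finite X], IsSupersoluble X → F X)
    {p : ℕ} (hp : p.Prime) {H V : Type u} [Group H] [Finite H] [AddCommGroup V] [Finite V]
    [Module (ZMod p) V] (ρ : Representation (ZMod p) H V) (χ : H →* (ZMod p)ˣ)
    (h : F (RepSemidirect ρ)) : F (RepSemidirect (ρ.twist χ)) := by
  have : NeZero p := ⟨hp.ne_zero⟩
  have hA : F (AffineLine p) := hU _ (AffineLine.isSupersoluble hp)
  refine hF.of_injective hS HeisenbergExt.ofTwist HeisenbergExt.ofTwist_injective (hsat _ ?_)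
  have hq := hF.quotient_inf (HeisenbergExt ρ χ) _ _
    (hF.quotient_ker hS HeisenbergExt.toRepSemidirect h)
    (hF.quotient_ker hS HeisenbergExt.toAffineLine hA)
  refine hF.quotient_mono (HeisenbergExt.le_frattini _ fun x => ?_) hq
  rw [Subgroup.mem_inf, MonoidHom.mem_ker, MonoidHom.mem_ker, RepSemidirect.ext_iff,
    AffineLine.ext_iff]
  constructor
  · rintro ⟨⟨h1, h2⟩, -, h3⟩
    exact ⟨h2, h3, h1⟩
  · rintro ⟨h1, h2, h3⟩
    refine ⟨⟨h3, h1⟩, ?_, h2⟩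
    change χ x.lin = 1
    rw [h1, map_one]

/-! ### Products of permuting subgroups -/

section Permuting

variable {G : Type*} [Group G]

namespace Subgroup

theorem exists_coe_eq_mul_of_mul_comm {A B : Subgroup G}
    (h : (A : Set G) * B = (B : Set G) * A) : ∃ X : Subgroup G, (X : Set G) = (A : Set G) * B :=
  ⟨{ carrier := (A : Set G) * B
     one_mem' := ⟨1, A.one_mem, 1, B.one_mem, mul_one 1⟩
     mul_mem' := fun {x y} hx hy => by
       have : x * y ∈ ((A : Set G) * B) * ((A : Set G) * B) := Set.mul_mem_mul hx hy
       rwa [mul_assoc, ← mul_assoc (B : Set G), ← h, mul_assoc, coe_mul_coe, ← mul_assoc,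
         coe_mul_coe] at this
     inv_mem' := fun {x} hx => by
       rw [h]
       obtain ⟨a, ha, b, hb, rfl⟩ := hx
       exact ⟨b⁻¹, B.inv_mem hb, a⁻¹, A.inv_mem ha, (mul_inv_rev a b).symm⟩ }, rfl⟩

theorem mul_comm_of_coe_eq_mul {A B X : Subgroup G} (h : (X : Set G) = (A : Set G) * B) :
    (X : Set G) = (B : Set G) * A := by
  rw [← inv_coe_set (H := X), h, mul_inv_rev, inv_coe_set, inv_coe_set]

theorem mul_eq_univ_comm {A B : Subgroup G} (h : (A : Set G) * (B : Set G) = Set.univ) :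
    (B : Set G) * (A : Set G) = Set.univ := by
  rw [← mul_comm_of_coe_eq_mul (X := ⊤) (by rw [coe_top, h]), coe_top]

theorem relIndex_eq_of_coe_eq_mul {A B X : Subgroup G} (h : (X : Set G) = (B : Set G) * A) :
    A.relIndex X = A.relIndex B := by
  have hBX : B ≤ X := fun b hb => by
    have : b ∈ (X : Set G) := h ▸ ⟨b, hb, 1, A.one_mem, mul_one b⟩
    exact this
  refine (Nat.card_congr (Equiv.ofBijective (quotientSubgroupOfEmbeddingOfLE A hBX)
    ⟨(quotientSubgroupOfEmbeddingOfLE A hBX).injective, fun q => ?_⟩)).symm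
  induction q using QuotientGroup.induction_on with
  | H x =>
    obtain ⟨b, hb, a, ha, e⟩ := (h ▸ x.2 : x.1 ∈ (B : Set G) * A)
    refine ⟨((⟨b, hb⟩ : B) : B ⧸ A.subgroupOf B), ?_⟩
    rw [quotientSubgroupOfEmbeddingOfLE_apply_mk, QuotientGroup.eq, mem_subgroupOf]
    have : b⁻¹ * x.1 = a := by rw [← e]; simp
    simpa [this] using ha

theorem index_dvd_card_of_mul_eq_univ {A B : Subgroup G}
    (h : (B : Set G) * (A : Set G) = Set.univ) : A.index ∣ Nat.card B := by
  have := relIndex_eq_of_coe_eq_mul (X := ⊤) (A := A) (B := B) (by simp [h])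
  rw [relIndex_top_right] at this
  exact this ▸ relIndex_dvd_card A B

theorem dvd_card_or_dvd_card_of_mul_eq_univ {A B : Subgroup G} {q : ℕ} (hq : q.Prime)
    (h : (A : Set G) * (B : Set G) = Set.univ) (hd : q ∣ Nat.card G) :
    q ∣ Nat.card A ∨ q ∣ Nat.card B := by
  rw [← B.card_mul_index] at hd
  exact ((hq.dvd_mul.1 hd).imp_right fun h' =>
    h'.trans (index_dvd_card_of_mul_eq_univ h)).symm

/-- A subgroup that contains a Sylow `q`-subgroup of `A` for each prime `q` contains `A`. -/
theorem le_of_forall_sylow_le [Finite G] {A K : Subgroup G}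
    (h : ∀ q : ℕ, q.Prime → ∃ Q : Sylow q A, (Q : Subgroup A).map A.subtype ≤ K) : A ≤ K := by
  rw [← relIndex_eq_one]
  by_contra hne
  obtain ⟨q, hq, hd⟩ := Nat.exists_prime_and_dvd hne
  have := Fact.mk hq
  obtain ⟨Q, hQ⟩ := h q hq
  exact Q.not_dvd_index (hd.trans (index_dvd_of_le (map_le_iff_le_comap.1 hQ)))

end Subgroup

open Subgroup

/-- Let `q < p` and let the `p`-group `P` permute with every subgroup of the `q`-group `Q`. Then
`Q` normalises `P`. By induction a subgroup of index `q` in `Q` normalises `P`; so the number of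
Sylow `p`-subgroups of `P * Q` divides `q`, and being `1` modulo `p > q` it is `1`. -/
theorem IsPGroup.le_normalizer_of_permutes [Finite G] {p q : ℕ} (hp : p.Prime) (hq : q.Prime)
    (hlt : q < p) {P : Subgroup G} (hP : IsPGroup p P) (n : ℕ) : ∀ (Q : Subgroup G),
    Nat.card Q = q ^ n → (∀ V ≤ Q, (P : Set G) * V = (V : Set G) * P) →
      Q ≤ normalizer (P : Set G) := by
  have := Fact.mk hp
  have := Fact.mk hq
  induction n with
  | zero =>
    intro Q hQ _
    rw [pow_zero, Subgroup.card_eq_one] at hQ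
    simp [hQ]
  | succ n ih =>
    intro Q hQ h
    obtain ⟨V', hV'⟩ := Sylow.exists_subgroup_card_pow_prime (G := Q) q
      (n := n) (hQ ▸ pow_dvd_pow q n.le_succ)
    have hVQ : V'.map Q.subtype ≤ Q := map_subtype_le V'
    have hVc : Nat.card (V'.map Q.subtype) = q ^ n := by
      rw [card_map_of_injective Q.subtype_injective, hV']
    have hVN := ih _ hVc fun W hW => h W (hW.trans hVQ)
    have hVi : (V'.map Q.subtype).relIndex Q = q := by
      have h1 : Nat.card V' * V'.index = Nat.card Q := V'.card_mul_index
      have h2 : (V'.map Q.subtype).subgroupOf Q = V' :=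
        comap_map_eq_self_of_injective Q.subtype_injective V'
      rw [relIndex, h2]
      rw [hV', hQ, pow_succ] at h1
      exact Nat.eq_of_mul_eq_mul_left (pow_pos hq.pos n) h1
    obtain ⟨X, hX⟩ := exists_coe_eq_mul_of_mul_comm (h Q le_rfl)
    have hX' := mul_comm_of_coe_eq_mul hX
    have hPX : P ≤ X := fun x hx => by
      have : x ∈ (X : Set G) := hX ▸ ⟨x, hx, 1, Q.one_mem, mul_one x⟩
      exact this
    have hQX : Q ≤ X := fun x hx => by
      have : x ∈ (X : Set G) := hX ▸ ⟨1, P.one_mem, x, hx, one_mul x⟩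
      exact this
    set N := normalizer (P : Set G)
    have hXN : (X : Set G) = (Q : Set G) * (N ⊓ X : Subgroup G) := by
      refine Set.Subset.antisymm ?_ ?_
      · rw [hX']
        exact Set.mul_subset_mul_left (fun x hx => ⟨le_normalizer hx, hPX hx⟩)
      · rintro _ ⟨a, ha, b, hb, rfl⟩
        exact X.mul_mem (hQX ha) hb.2
    have hm : N.relIndex X ∣ q := by
      rw [← inf_relIndex_right, relIndex_eq_of_coe_eq_mul hXN,
        ← inf_relIndex_right, inf_assoc, inf_eq_right.2 hQX, inf_relIndex_right, ← hVi]
      exact relIndex_dvd_of_le_left _ hVN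
    have hPi : ¬ p ∣ (P.subgroupOf X).index := fun hd => by
      have h1 : P.relIndex X ∣ q ^ (n + 1) := by
        rw [relIndex_eq_of_coe_eq_mul hX', ← hQ]
        exact relIndex_dvd_card _ _
      exact hlt.ne' ((Nat.prime_dvd_prime_iff_eq hp hq).1 (hp.dvd_of_dvd_pow (hd.trans h1)))
    let S : Sylow p X := (hP.comap_subtype (K := X)).toSylow hPi
    have hc : Nat.card (Sylow p X) = N.relIndex X := by
      rw [S.card_eq_index_normalizer]
      change (normalizer ((P.subgroupOf X : Subgroup X) : Set X)).index = _
      rw [← subgroupOf_normalizer_eq hPX, relIndex]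
    have hmod := card_sylow_modEq_one p X
    rw [hc] at hmod
    have h1 : N.relIndex X = 1 := by
      rcases (Nat.dvd_prime hq).1 hm with e | e
      · exact e
      · rw [e] at hmod ⊢
        exact Nat.ModEq.eq_of_lt_of_lt hmod hlt hp.one_lt
    exact hQX.trans (relIndex_eq_one.1 h1)

/-- A `q`-group that permutes with a subgroup `U` of a normal `p`-group, `q ≠ p`, normalises
`U`, since `U` is the intersection of the product with that normal `p`-group. -/
theorem IsPGroup.le_normalizer_of_mul_comm {p q : ℕ} (hp : p.Prime) (hq : q.Prime)
    (hne : q ≠ p) {N U Q : Subgroup G} [hN : N.Normal] (hNp : IsPGroup p N) (hQ : IsPGroup q Q)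
    (hU : U ≤ N) (h : (U : Set G) * Q = (Q : Set G) * U) : Q ≤ normalizer (U : Set G) := by
  have := Fact.mk hp
  have := Fact.mk hq
  rw [le_normalizer_iff]
  intro x hx u hu
  obtain ⟨v, hv, y, hy, e⟩ : x * u ∈ (U : Set G) * Q := h ▸ Set.mul_mem_mul hx hu
  simp only at e
  have e' : x * u * x⁻¹ = v * (y * x⁻¹) := by rw [← e, mul_assoc]
  have h1 : y * x⁻¹ ∈ N := by
    have : y * x⁻¹ = v⁻¹ * (x * u * x⁻¹) := by rw [e']; simp
    rw [this]
    exact N.mul_mem (N.inv_mem (hU hv)) (hN.conj_mem u (hU hu) x)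
  have h2 : y * x⁻¹ = 1 := Subgroup.disjoint_def.1
    (IsPGroup.disjoint_of_ne p q hne.symm N Q hNp hQ) h1 (Q.mul_mem hy (Q.inv_mem hx))
  rw [e', h2, mul_one]
  exact hv

end Permuting

/-! ### Sylow towers -/

/-- If `p` is at least as large as each prime divisor of the order of a group with an ordered
Sylow tower, then its Sylow `p`-subgroups are normal: either `p` does not divide the order, or
the first term of the tower is a Sylow `p`-subgroup. -/
theorem HasOrderedSylowTower.sylow_normal {G : Type u} [Group G] [Finite G]
    (h : HasOrderedSylowTower G) {p : ℕ} (hp : p.Prime)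
    (hmax : ∀ q : ℕ, q.Prime → q ∣ Nat.card G → q ≤ p) (P : Sylow p G) :
    (P : Subgroup G).Normal := by
  have := Fact.mk hp
  by_cases hd : p ∣ Nat.card G
  · obtain ⟨n, r, S, hn, hanti, hr, hmono, h0, h1, hS⟩ := h
    obtain ⟨i, hi⟩ : p ∈ Set.range r := hr ▸ ⟨hp, hd⟩
    obtain ⟨m, rfl⟩ : ∃ m, n = m + 1 := ⟨n - 1, by have := i.2; omega⟩
    have hr0 : r 0 = p := by
      have h2 : r 0 ∈ {q : ℕ | q.Prime ∧ q ∣ Nat.card G} := hr ▸ ⟨0, rfl⟩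
      exact le_antisymm (hmax _ h2.1 h2.2) (hi ▸ hanti.antitone (Fin.zero_le i))
    obtain ⟨Q, ⟨e⟩⟩ := hS 0
    subst hr0
    have hcard : Nat.card (S (Fin.succ 0)) = Nat.card P := by
      have e1 := Nat.card_congr e.toEquiv
      rw [← Subgroup.index_eq_card, Fin.castSucc_zero, h0, Subgroup.bot_subgroupOf,
        Subgroup.index_bot] at e1
      rw [e1, Q.card_eq_multiplicity, P.card_eq_multiplicity]
    have := hn (Fin.succ 0)
    have hle : S (Fin.succ 0) ≤ P := IsPGroup.le_sylow_of_normal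
      (IsPGroup.of_card (hcard.trans P.card_eq_multiplicity)) P
    rw [← Subgroup.eq_of_le_of_card_ge hle hcard.ge]
    exact this
  · have : (P : Subgroup G) = ⊥ := by
      rw [← Subgroup.card_eq_one]
      by_contra hne
      have : IsPGroup p P := P.2
      exact hd ((this.card_eq_or_dvd.resolve_left hne).trans (Subgroup.card_subgroup_dvd_card _))
    rw [this]
    infer_instance

/-! ### msp-permutable products -/

section Msp

variable {G : Type*} [Group G]

open Subgroup

theorem MutuallyPermutable.symm {A B : Subgroup G} (h : MutuallyPermutable A B) :
    MutuallyPermutable B A :=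
  ⟨fun U hU => (h.2 U hU).symm, fun V hV => (h.1 V hV).symm⟩

theorem MutuallyPermutable.map {G' : Type*} [Group G'] (f : G →* G') {A B : Subgroup G}
    (h : MutuallyPermutable A B) : MutuallyPermutable (A.map f) (B.map f) := by
  have key : ∀ {A U : Subgroup G'} {C : Subgroup G}, A = C.map f → U ≤ A →
      ∃ W ≤ C, W.map f = U := by
    rintro _ U C rfl hU
    refine ⟨C ⊓ U.comap f, inf_le_left, le_antisymm ?_ fun u hu => ?_⟩
    · exact map_le_iff_le_comap.2 inf_le_right
    · obtain ⟨c, hc, rfl⟩ := hU hu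
      exact ⟨c, ⟨hc, hu⟩, rfl⟩
  constructor
  · intro U hU
    obtain ⟨W, hW, rfl⟩ := key rfl hU
    rw [coe_map, coe_map, ← Set.image_mul, h.1 W hW, Set.image_mul]
  · intro V hV
    obtain ⟨W, hW, rfl⟩ := key rfl hV
    rw [coe_map, coe_map, ← Set.image_mul, h.2 W hW, Set.image_mul]

theorem MspPermutable.symm {A B : Subgroup G} (h : MspPermutable A B) : MspPermutable B A where
  mul_isSubgroup := by
    obtain ⟨X, hX⟩ := h.mul_isSubgroup
    exact ⟨X, mul_comm_of_coe_eq_mul hX⟩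
  mutuallyPermutable p q hp hq hne P Q := (h.mutuallyPermutable q p hq hp hne.symm Q P).symm

theorem MspPermutable.map [Finite G] {G' : Type*} [Group G'] (f : G →* G') {A B : Subgroup G}
    (h : MspPermutable A B) : MspPermutable (A.map f) (B.map f) where
  mul_isSubgroup := by
    obtain ⟨X, hX⟩ := h.mul_isSubgroup
    exact ⟨X.map f, by rw [coe_map, hX, Set.image_mul, coe_map, coe_map]⟩
  mutuallyPermutable p q hp hq hne P Q := by
    have := Fact.mk hp
    have := Fact.mk hq
    have key : ∀ (C : Subgroup G) (S : Subgroup C),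
        (S.map (f.subgroupMap C)).map (C.map f).subtype = (S.map C.subtype).map f := by
      intro C S
      rw [map_map, map_map]
      rfl
    obtain ⟨P, rfl⟩ := Sylow.mapSurjective_surjective (f.subgroupMap_surjective A) p P
    obtain ⟨Q, rfl⟩ := Sylow.mapSurjective_surjective (f.subgroupMap_surjective B) q Q
    rw [Sylow.coe_mapSurjective, Sylow.coe_mapSurjective, key, key]
    exact (h.mutuallyPermutable p q hp hq hne P Q).map f

/-- For the largest prime `p`, the factor `A` normalises the subgroup generated by its own normal
Sylow `p`-subgroup and a Sylow `p`-subgroup `R` of `B`: all subgroups of the other Sylow subgroups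
of `A` permute with `R`, so the latter normalise `R`. -/
theorem MspPermutable.le_normalizer_sylow_sup [Finite G] {A B : Subgroup G}
    (h : MspPermutable A B) {p : ℕ} (hp : p.Prime)
    (hmax : ∀ q : ℕ, q.Prime → q ∣ Nat.card G → q ≤ p) (P : Sylow p A) (R : Sylow p B)
    (hP : (P : Subgroup A).Normal) :
    A ≤ normalizer (((P : Subgroup A).map A.subtype ⊔ (R : Subgroup B).map B.subtype :
      Subgroup G) : Set G) := by
  have := Fact.mk hp
  have hAP : A ≤ normalizer (((P : Subgroup A).map A.subtype : Subgroup G) : Set G) := by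
    rw [le_normalizer_iff]
    rintro a ha _ ⟨x, hx, rfl⟩
    exact ⟨⟨a, ha⟩ * x * ⟨a, ha⟩⁻¹, hP.conj_mem x hx _, rfl⟩
  refine le_of_forall_sylow_le fun q hq => ?_
  have := Fact.mk hq
  by_cases hqp : q = p
  · subst hqp
    exact ⟨P, le_sup_left.trans le_normalizer⟩
  refine ⟨default, le_trans (le_inf ((map_subtype_le _).trans hAP) ?_)
    (normalizer_inf_normalizer_le_normalizer_sup _ _)⟩
  set Q : Sylow q A := default
  obtain ⟨n, hn⟩ := IsPGroup.iff_card.1 (Q.2.map A.subtype)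
  rcases n with - | n
  · rw [pow_zero, Subgroup.card_eq_one] at hn
    rw [hn]
    exact bot_le
  · have hqd : q ∣ Nat.card G := (hn ▸ dvd_pow_self q n.succ_ne_zero).trans
      (card_subgroup_dvd_card _)
    exact IsPGroup.le_normalizer_of_permutes hp hq ((hmax q hq hqd).lt_of_ne hqp)
      (R.2.map B.subtype) _ _ hn fun V hV =>
      ((h.mutuallyPermutable q p hq hp hqp Q R).1 V hV).symm

/-- A product of msp-permutable subgroups with ordered Sylow towers has a normal Sylow subgroup
for the largest prime `p`: it is generated by the Sylow `p`-subgroups of the factors. -/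
theorem MspPermutable.exists_normal_sylow {G : Type u} [Group G] [Finite G] {A B : Subgroup G}
    (h : MspPermutable A B) (hAB : (A : Set G) * (B : Set G) = Set.univ)
    (hA : HasOrderedSylowTower A) (hB : HasOrderedSylowTower B) {p : ℕ} (hp : p.Prime)
    (hmax : ∀ q : ℕ, q.Prime → q ∣ Nat.card G → q ≤ p) :
    ∃ P : Sylow p G, (P : Subgroup G).Normal := by
  have := Fact.mk hp
  have hmaxs : ∀ C : Subgroup G, ∀ q : ℕ, q.Prime → q ∣ Nat.card C → q ≤ p := fun C q hq hd =>
    hmax q hq (hd.trans (card_subgroup_dvd_card C))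
  let P : Sylow p A := default
  let R : Sylow p B := default
  have hP := hA.sylow_normal hp (hmaxs A) P
  have hR := hB.sylow_normal hp (hmaxs B) R
  set P' := (P : Subgroup A).map A.subtype
  set R' := (R : Subgroup B).map B.subtype
  have hBA := mul_eq_univ_comm hAB
  have hT : (P' ⊔ R').Normal := by
    rw [← normalizer_eq_top_iff, eq_top_iff']
    intro g
    obtain ⟨a, ha, b, hb, rfl⟩ : g ∈ (A : Set G) * (B : Set G) := hAB ▸ Set.mem_univ g
    refine mul_mem (h.le_normalizer_sylow_sup hp hmax P R hP ha) ?_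
    have := h.symm.le_normalizer_sylow_sup hp hmax R P hR hb
    rwa [sup_comm] at this
  -- after conjugation in `A` and in `B` both Sylow subgroups lie in one Sylow subgroup of `G`
  have hTp : IsPGroup p (P' ⊔ R' : Subgroup G) := by
    obtain ⟨S, hS⟩ := (P.2.map A.subtype).exists_le_sylow
    obtain ⟨S₂, hS₂⟩ := (R.2.map B.subtype).exists_le_sylow
    obtain ⟨g, rfl⟩ := MulAction.exists_smul_eq G S S₂
    obtain ⟨b, hb, a, ha, rfl⟩ : g ∈ (B : Set G) * (A : Set G) := hBA ▸ Set.mem_univ g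
    refine (a • S).2.to_le (sup_le ?_ ?_)
    · rintro _ ⟨x, hx, rfl⟩
      have h1 : a⁻¹ * x.1 * a ∈ (S : Subgroup G) :=
        hS ⟨⟨a, ha⟩⁻¹ * x * ⟨a, ha⟩, by
          have h2 := hP.conj_mem x hx ⟨a, ha⟩⁻¹
          rwa [inv_inv] at h2, rfl⟩
      change x.1 ∈ ((a • S : Sylow p G) : Subgroup G)
      rw [Sylow.coe_subgroup_smul, Subgroup.mem_pointwise_smul_iff_inv_smul_mem]
      simpa [MulAut.smul_def] using h1
    · rintro _ ⟨x, hx, rfl⟩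
      have h1 : b * x.1 * b⁻¹ ∈ (((b * a) • S : Sylow p G) : Subgroup G) :=
        hS₂ ⟨⟨b, hb⟩ * x * ⟨b, hb⟩⁻¹, hR.conj_mem x hx ⟨b, hb⟩, rfl⟩
      change x.1 ∈ ((a • S : Sylow p G) : Subgroup G)
      rw [Sylow.coe_subgroup_smul, Subgroup.mem_pointwise_smul_iff_inv_smul_mem] at h1 ⊢
      simpa [MulAut.smul_def, mul_assoc] using h1
  have hdvd : ∀ (C : Subgroup G) (S : Sylow p C), (S : Subgroup C).map C.subtype ≤ P' ⊔ R' →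
      ¬ p ∣ Nat.card (C.map (QuotientGroup.mk' (P' ⊔ R'))) := by
    intro C S hS hd
    rw [← relIndex_ker, QuotientGroup.ker_mk'] at hd
    exact S.not_dvd_index (hd.trans (index_dvd_of_le (map_le_iff_le_comap.1 hS)))
  have hi : ¬ p ∣ (P' ⊔ R').index := fun hd => by
    rcases dvd_card_or_dvd_card_of_mul_eq_univ hp
      (A := A.map (QuotientGroup.mk' (P' ⊔ R'))) (B := B.map (QuotientGroup.mk' (P' ⊔ R')))
      (by rw [coe_map, coe_map, ← Set.image_mul, hAB, Set.image_univ,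
            (QuotientGroup.mk'_surjective _).range_eq]) hd with h1 | h1
    · exact hdvd A P le_sup_left h1
    · exact hdvd B R le_sup_right h1
  exact ⟨hTp.toSylow hi, hT⟩

/-- Let `N` be an abelian normal Sylow `p`-subgroup of `G`. Then `B` normalises every subgroup
`U` of `A ⊓ N`: its Sylow `p`-subgroups lie in `N` and centralise `U`, and its other Sylow
subgroups permute with `U`. -/
theorem MspPermutable.le_normalizer [Finite G] {A B : Subgroup G} (h : MspPermutable A B)
    {p : ℕ} (hp : p.Prime) (N : Sylow p G) [hN : (N : Subgroup G).Normal]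
    (hab : ∀ x ∈ N, ∀ y ∈ N, x * y = y * x) {U : Subgroup G} (hUA : U ≤ A) (hUN : U ≤ N) :
    B ≤ normalizer (U : Set G) := by
  have := Fact.mk hp
  refine le_of_forall_sylow_le fun q hq => ?_
  have := Fact.mk hq
  refine ⟨default, ?_⟩
  set Q : Sylow q B := default
  by_cases hqp : q = p
  · subst hqp
    have := Sylow.unique_of_normal N hN
    obtain ⟨S, hS⟩ := (Q.2.map B.subtype).exists_le_sylow
    rw [Subsingleton.elim S N] at hS
    rw [le_normalizer_iff]
    intro x hx u hu
    rw [hab x (hS hx) u (hUN hu), mul_inv_cancel_right]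
    exact hu
  · have hUp : IsPGroup p (U.subgroupOf A) := (N.2.to_le hUN).comap_subtype
    obtain ⟨P, hP⟩ := hUp.exists_le_sylow
    have hU : U ≤ (P : Subgroup A).map A.subtype := fun u hu =>
      ⟨⟨u, hUA hu⟩, hP (mem_subgroupOf.2 hu), rfl⟩
    exact IsPGroup.le_normalizer_of_mul_comm hp hq hqp N.2 (Q.2.map B.subtype) hUN
      ((h.mutuallyPermutable p q hp hq (Ne.symm hqp) P Q).1 U hU)

end Msp

/-! ### Groups with trivial Frattini subgroup and a normal Sylow subgroup -/

section Primitive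

open Subgroup

variable {G : Type*} [Group G] [Finite G]

/-- Suppose that `Φ(G) = 1` and that nontrivial normal subgroups of `G` intersect nontrivially.
Then a nontrivial normal Sylow subgroup `P` is a complemented elementary abelian minimal normal
subgroup. A minimal normal subgroup `N` of `G` in the centre of `P` is complemented by a maximal
subgroup `L`, and `P ⊓ L` is normal because `N` centralises it; so `P ⊓ L = 1` and `P = N`. -/
theorem Sylow.exists_complement_of_frattini_eq_bot {p : ℕ} (hp : p.Prime) (P : Sylow p G)
    (hP : (P : Subgroup G).Normal) (hne : (P : Subgroup G) ≠ ⊥) (hfr : frattini G = ⊥)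
    (hirr : ∀ M N : Subgroup G, M.Normal → N.Normal → M ⊓ N = ⊥ → M = ⊥ ∨ N = ⊥) :
    (∀ x ∈ P, ∀ y ∈ P, x * y = y * x) ∧ (∀ x ∈ P, x ^ p = 1) ∧
    (∀ K : Subgroup G, K.Normal → K ≤ P → K = ⊥ ∨ K = P) ∧
    ∃ L : Subgroup G, (P : Subgroup G) ⊓ L = ⊥ ∧ (P : Subgroup G) ⊔ L = ⊤ := by
  have := Fact.mk hp
  set C : Subgroup G := P ⊓ centralizer ((P : Subgroup G) : Set G)
  have hCn : C.Normal := inferInstance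
  have hCne : C ≠ ⊥ := by
    have : Nontrivial P := (Subgroup.nontrivial_iff_ne_bot _).2 hne
    obtain ⟨z, hz, hz1⟩ := (bot_or_exists_ne_one _).resolve_left P.2.bot_lt_center.ne'
    intro hbot
    have h1 : (z : G) ∈ C := ⟨z.2, mem_centralizer_iff.2 fun x hx =>
      congrArg Subtype.val (mem_center_iff.1 hz ⟨x, hx⟩)⟩
    rw [hbot, mem_bot, OneMemClass.coe_eq_one] at h1
    exact hz1 h1
  obtain ⟨N, hN⟩ := (Set.toFinite {K : Subgroup G | K.Normal ∧ K ≠ ⊥ ∧ K ≤ C}).exists_minimal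
    ⟨C, hCn, hCne, le_rfl⟩
  obtain ⟨⟨hNn, hNne, hNC⟩, hmin⟩ := hN
  have hNP : N ≤ P := hNC.trans inf_le_left
  have hcomm : ∀ n ∈ N, ∀ x ∈ P, n * x = x * n := fun n hn x hx =>
    ((mem_centralizer_iff.1 (hNC hn).2) x hx).symm
  obtain ⟨L, hL, hNL⟩ : ∃ L : Subgroup G, IsCoatom L ∧ ¬ N ≤ L := by
    by_contra! hcon
    exact hNne (le_bot_iff.1 (hfr ▸ le_iInf₂ hcon))
  have hsup : N ⊔ L = ⊤ := hL.2 _ (right_lt_sup.2 hNL)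
  have hfac : ∀ g : G, ∃ n ∈ N, ∃ l ∈ L, n * l = g := fun g => by
    have : g ∈ N ⊔ L := hsup ▸ mem_top g
    rwa [mem_sup_of_normal_left] at this
  have hnorm : ∀ D : Subgroup G, D.Normal → D ≤ P → (D ⊓ L).Normal := by
    refine fun D hD hDP => ⟨fun x hx g => ?_⟩
    obtain ⟨n, hn, l, hl, rfl⟩ := hfac g
    have h1 : l * x * l⁻¹ ∈ D := hD.conj_mem x hx.1 l
    have h2 : n * l * x * (n * l)⁻¹ = l * x * l⁻¹ := by
      have := hcomm n hn _ (hDP h1)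
      rw [mul_inv_rev, ← mul_assoc, mul_inv_eq_iff_eq_mul, ← this]
      simp only [mul_assoc]
    rw [h2]
    exact ⟨h1, L.mul_mem (L.mul_mem hl hx.2) (L.inv_mem hl)⟩
  have hNLbot : N ⊓ L = ⊥ := by
    by_contra hcon
    exact hNL ((hmin ⟨hnorm N hNn hNP, hcon, inf_le_left.trans hNC⟩ inf_le_left).trans
      inf_le_right)
  have hPLbot : (P : Subgroup G) ⊓ L = ⊥ :=
    (hirr _ N (hnorm P hP le_rfl) hNn (by
      rw [inf_assoc, inf_comm L, hNLbot, inf_bot_eq])).resolve_right hNne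
  have hPN : (P : Subgroup G) = N := by
    refine le_antisymm (fun x hx => ?_) hNP
    obtain ⟨n, hn, l, hl, rfl⟩ := hfac x
    have h1 : l ∈ (P : Subgroup G) ⊓ L := ⟨by
      have := (P : Subgroup G).mul_mem ((P : Subgroup G).inv_mem (hNP hn)) hx
      rwa [inv_mul_cancel_left] at this, hl⟩
    rw [hPLbot, mem_bot] at h1
    rwa [h1, mul_one]
  have hmin' : ∀ K : Subgroup G, K.Normal → K ≤ P → K = ⊥ ∨ K = P := by
    intro K hK hKP
    rw [or_iff_not_imp_left]
    intro hKne
    rw [hPN] at hKP ⊢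
    exact le_antisymm hKP (hmin ⟨hK, hKne, hKP.trans hNC⟩ hKP)
  have hab : ∀ x ∈ P, ∀ y ∈ P, x * y = y * x := fun x hx y hy =>
    hcomm x (hPN ▸ hx : x ∈ N) y hy
  refine ⟨hab, ?_, hmin', L, hPLbot, hPN ▸ hsup⟩
  -- the elements of order dividing `p` form a nontrivial normal subgroup
  let K : Subgroup G :=
    { carrier := {x | x ∈ P ∧ x ^ p = 1}
      one_mem' := ⟨(P : Subgroup G).one_mem, one_pow p⟩
      mul_mem' := fun {x y} hx hy => ⟨(P : Subgroup G).mul_mem hx.1 hy.1, by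
        rw [(show Commute x y from hab x hx.1 y hy.1).mul_pow, hx.2, hy.2, one_mul]⟩
      inv_mem' := fun {x} hx => ⟨(P : Subgroup G).inv_mem hx.1, by rw [inv_pow, hx.2, inv_one]⟩ }
  have hK : K.Normal := ⟨fun x hx g => ⟨hP.conj_mem x hx.1 g, by
    rw [conj_pow, hx.2, mul_one, mul_inv_cancel]⟩⟩
  have hKP : K = P := by
    refine (hmin' K hK fun x hx => hx.1).resolve_left fun hbot => ?_
    have hd : p ∣ Nat.card P := by
      refine P.2.card_eq_or_dvd.resolve_left fun h1 => hne ?_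
      exact Subgroup.card_eq_one.1 h1
    obtain ⟨x, hx⟩ := exists_prime_orderOf_dvd_card' p hd
    have h1 : (x : G) ∈ K := ⟨x.2, by
      rw [← coe_pow, orderOf_dvd_iff_pow_eq_one.1 hx.dvd, coe_one]⟩
    rw [hbot, mem_bot, OneMemClass.coe_eq_one] at h1
    rw [h1, orderOf_one] at hx
    exact hp.one_lt.ne hx
  intro x hx
  have h1 : x ∈ (P : Subgroup G) := hx
  rw [← hKP] at h1
  exact h1.2

end Primitive

/-! ### Factors acting by scalars on a normal subgroup -/

section Scalar

open Subgroup
open scoped IsMulCommutative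

variable {G : Type u} [Group G] (N : Subgroup G) [hN : N.Normal] [IsMulCommutative N] (p : ℕ)
  [Module (ZMod p) (Additive N)]

/-- The conjugation action on an abelian normal subgroup of exponent `p`, as a representation. -/
def conjRep : Representation (ZMod p) G (Additive N) where
  toFun g := (MonoidHom.toAdditive (MulAut.conjNormal g : MulAut N).toMonoidHom).toZModLinearMap p
  map_one' := by
    ext v
    simp
  map_mul' g h := by
    ext v
    simp

theorem coe_conjRep (g : G) (v : Additive N) :
    ((conjRep N p g v).toMul : G) = g * v.toMul * g⁻¹ := rfl

variable {N p}

/-- An element that normalises every subgroup of an elementary abelian group acts as a scalar. -/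
theorem exists_conjRep_eq_smul (hp : p.Prime) {a : G}
    (ha : ∀ U : Subgroup G, U ≤ N → a ∈ normalizer (U : Set G)) :
    ∃ z : (ZMod p)ˣ, ∀ v, conjRep N p a v = (z : ZMod p) • v := by
  have := Fact.mk hp
  rcases subsingleton_or_nontrivial (Additive N) with hs | hs
  · exact ⟨1, fun v => Subsingleton.elim _ _⟩
  obtain ⟨c, hc⟩ := LinearMap.exists_eq_smul_id_of_forall_notLinearIndependent
    (f := conjRep N p a) fun v hv => by
      have h1 : a * v.toMul * a⁻¹ ∈ zpowers (v.toMul : G) :=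
        (mem_normalizer_iff.1 (ha (zpowers (v.toMul : G))
          (zpowers_le.2 v.toMul.2)) _).1 (mem_zpowers _)
      obtain ⟨k, hk⟩ := mem_zpowers_iff.1 h1
      have h2 : conjRep N p a v = (k : ZMod p) • v := by
        rw [Int.cast_smul_eq_zsmul]
        apply Additive.toMul.injective
        apply Subtype.ext
        rw [coe_conjRep, ← hk]
        rfl
      have h3 := LinearIndependent.pair_iff.1 hv (k : ZMod p) (-1) (by rw [h2]; simp)
      simpa using h3.2
  have hc' : ∀ v, conjRep N p a v = c • v := fun v => by rw [hc]; rfl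
  have hc0 : c ≠ 0 := by
    rintro rfl
    obtain ⟨v, hv⟩ := exists_ne (0 : Additive N)
    apply hv
    rw [← (conjRep N p).inv_self_apply a v, hc' v, zero_smul, map_zero]
  exact ⟨Units.mk0 c hc0, hc'⟩

/-- Let `N ≤ B` be a complemented elementary abelian normal subgroup of `G = A * B` such that `A`
normalises every subgroup of `N`. If `B` and `G ⧸ N` lie in the formation, so does `G`. Let `Γ`
consist of the triples `(z, b, l)`, with `b` in `B` and `l` in the complement `L`, such that `l`
acts on `N` as `z • b`. The semidirect product of `N` with `Γ` acting through `b` embeds into a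
product of groups of the formation, and its twist by `z`, in which `Γ` acts through `l`, has `G`
as a quotient. -/
theorem IsSaturated.of_scalar_factor {F : FinGroupClass.{u}} (hsat : IsSaturated F)
    (hF : IsFormation F) (hS : IsSubgroupClosed F)
    (hU : ∀ (X : Type u) [Group X] [Finite X], IsSupersoluble X → F X) [Finite G]
    (hp : p.Prime) {A B L : Subgroup G} (hL : N ⊓ L = ⊥) (hNL : N ⊔ L = ⊤) (hNB : N ≤ B)
    (hAB : (A : Set G) * (B : Set G) = Set.univ)
    (hA : ∀ U : Subgroup G, U ≤ N → A ≤ normalizer (U : Set G))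
    (hB : F B) (hQ : F (G ⧸ N)) : F G := by
  have : NeZero p := ⟨hp.ne_zero⟩
  have hLF : F L := hF.of_injective hS ((QuotientGroup.mk' N).comp L.subtype)
    ((injective_iff_map_eq_one _).2 fun l hl => by
      have h1 : (l : G) ∈ N ⊓ L := ⟨(QuotientGroup.eq_one_iff _).1 hl, l.2⟩
      rw [hL, mem_bot] at h1
      exact Subtype.ext h1) hQ
  have hAff : F (AffineLine p) := hU _ (AffineLine.isSupersoluble hp)
  let Γ : Subgroup ((ZMod p)ˣ × B × L) :=
    { carrier := {γ | ∀ v, conjRep N p γ.2.2 v = (γ.1 : ZMod p) • conjRep N p γ.2.1 v}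
      one_mem' := fun v => by simp
      mul_mem' := fun {x y} hx hy v => by
        simp only [Prod.fst_mul, Prod.snd_mul, coe_mul, map_mul, Module.End.mul_apply,
          Units.val_mul]
        rw [hy, map_smul, hx, smul_smul, mul_comm]
      inv_mem' := fun {x} hx v => by
        have h1 := hx (conjRep N p (x.2.1 : G)⁻¹ v)
        rw [Representation.self_inv_apply] at h1
        simp only [Prod.fst_inv, Prod.snd_inv, coe_inv]
        have h2 : v = (↑x.1⁻¹ : ZMod p) •
            conjRep N p (x.2.2 : G) (conjRep N p (x.2.1 : G)⁻¹ v) := by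
          rw [h1, smul_smul, Units.inv_mul, one_smul]
        conv_lhs => rw [h2]
        rw [map_smul, Representation.inv_self_apply] }
  let ρ : Representation (ZMod p) Γ (Additive N) := (conjRep N p).comp
    (B.subtype.comp ((MonoidHom.fst B L).comp ((MonoidHom.snd (ZMod p)ˣ (B × L)).comp Γ.subtype)))
  let χ : Γ →* (ZMod p)ˣ := (MonoidHom.fst _ _).comp Γ.subtype
  have hmul : ∀ (x y : G) (v w : Additive N), (((conjRep N p x w + v).toMul : N) : G) * (x * y) =
      v.toMul * x * (w.toMul * y) := fun x y v w => by
    rw [add_comm, toMul_add, coe_mul, coe_conjRep]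
    simp [mul_assoc]
  -- the map `(v, γ) ↦ v * b`
  let f₁ : RepSemidirect ρ →* B :=
    { toFun := fun x => ⟨x.vec.toMul, hNB x.vec.toMul.2⟩ * x.lin.1.2.1
      map_one' := by ext; simp
      map_mul' := fun x y => by
        ext
        exact hmul (x.lin.1.2.1 : G) _ _ _ }
  let πΓ : RepSemidirect ρ →* Γ := ⟨⟨RepSemidirect.lin, rfl⟩, fun _ _ => rfl⟩
  let f₂ : RepSemidirect ρ →* B :=
    (MonoidHom.fst B L).comp ((MonoidHom.snd (ZMod p)ˣ (B × L)).comp (Γ.subtype.comp πΓ))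
  let f₃ : RepSemidirect ρ →* L :=
    (MonoidHom.snd B L).comp ((MonoidHom.snd (ZMod p)ˣ (B × L)).comp (Γ.subtype.comp πΓ))
  let f₄ : RepSemidirect ρ →* AffineLine.{u} p :=
    { toFun := fun x => ⟨χ x.lin, 0⟩
      map_one' := AffineLine.ext (map_one χ) rfl
      map_mul' := fun x y => AffineLine.ext (map_mul χ _ _) (by simp) }
  have hX : F (RepSemidirect ρ) := by
    refine hF.of_injective_prod hS (f₁.prod f₂) (f₃.prod f₄) ?_ (hF.prod hS hB hB)
      (hF.prod hS hLF hAff)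
    intro x h1 h2
    have e1 : f₁ x = 1 := congrArg Prod.fst h1
    have e2 : x.lin.1.2.1 = 1 := congrArg Prod.snd h1
    have e3 : x.lin.1.2.2 = 1 := congrArg Prod.fst h2
    have e4 : x.lin.1.1 = 1 := congrArg AffineLine.unit (congrArg Prod.snd h2)
    refine RepSemidirect.ext ?_ (Subtype.ext (Prod.ext e4 (Prod.ext e2 e3)))
    have e5 : (⟨x.vec.toMul, hNB x.vec.toMul.2⟩ : B) * x.lin.1.2.1 = 1 := e1
    rw [e2, mul_one] at e5
    exact Additive.toMul.injective (Subtype.ext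
      (show (x.vec.toMul : G) = 1 from congrArg (Subtype.val : B → G) e5))
  -- the map `(t, γ) ↦ t * l`
  let g : RepSemidirect (ρ.twist χ) →* G :=
    { toFun := fun x => x.vec.toMul * x.lin.1.2.2
      map_one' := by simp
      map_mul' := fun x y => by
        have h1 : ρ.twist χ x.lin y.vec = conjRep N p x.lin.1.2.2 y.vec := (x.lin.2 y.vec).symm
        rw [RepSemidirect.vec_mul, h1]
        exact hmul (x.lin.1.2.2 : G) _ _ _ }
  refine hF.of_surjective g (fun y => ?_) (hsat.repSemidirect_twist hF hS hU hp ρ χ hX)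
  have hy : y ∈ N ⊔ L := hNL ▸ mem_top y
  rw [mem_sup_of_normal_left] at hy
  obtain ⟨n, hn, l, hl, rfl⟩ := hy
  obtain ⟨a, ha, b, hb, hab⟩ : l ∈ (A : Set G) * (B : Set G) := hAB ▸ Set.mem_univ l
  obtain ⟨z, hz⟩ := exists_conjRep_eq_smul (N := N) hp (a := a) fun U hU => hA U hU ha
  refine ⟨⟨Additive.ofMul ⟨n, hn⟩, ⟨(z, ⟨b, hb⟩, ⟨l, hl⟩), fun v => ?_⟩⟩, rfl⟩
  change conjRep N p l v = (z : ZMod p) • conjRep N p b v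
  rw [← hab, map_mul, Module.End.mul_apply, hz]

end Scalar

/-! ### Products of msp-permutable subgroups in a formation -/

open Subgroup in
/-- The inductive step. If `G` were not in `F`, saturation and the formation property would make
the normal Sylow subgroup `P` for the largest prime `p` an elementary abelian minimal normal
subgroup with a complement. The intersection of `P` with either factor is normal in `G`, so one
of the factors contains `P`, and then the other one acts on `P` by scalars. -/
theorem MspPermutable.mem_of_forall_quotient {F : FinGroupClass.{u}}
    (hF : IsFormation F) (hsat : IsSaturated F) (hS : IsSubgroupClosed F)
    (hU : ∀ (X : Type u) [Group X] [Finite X], IsSupersoluble X → F X)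
    (hD : ∀ (X : Type u) [Group X] [Finite X], F X → HasOrderedSylowTower X)
    {G : Type u} [Group G] [Finite G] {A B : Subgroup G} (h : MspPermutable A B)
    (hAB : (A : Set G) * (B : Set G) = Set.univ) (hA : F A) (hB : F B)
    (hquot : ∀ (K : Subgroup G) [K.Normal], K ≠ ⊥ → F (G ⧸ K)) : F G := by
  by_contra hG
  have hirr : ∀ M N : Subgroup G, M.Normal → N.Normal → M ⊓ N = ⊥ → M = ⊥ ∨ N = ⊥ := by
    intro M N hM hN hMN
    by_contra! hne
    exact hG (hF.of_inf_le_bot hMN.le (hquot M hne.1) (hquot N hne.2))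
  have hfr : frattini G = ⊥ := by
    by_contra hne
    exact hG (hsat G (hquot _ hne))
  have hnt : Nontrivial G := by
    by_contra hnt
    rw [not_nontrivial_iff_subsingleton] at hnt
    exact hG (hU G (isSupersoluble_of_subsingleton G))
  obtain ⟨p, ⟨hp, hpd⟩, hmax⟩ : ∃ p, (p.Prime ∧ p ∣ Nat.card G) ∧
      ∀ q : ℕ, q.Prime → q ∣ Nat.card G → q ≤ p := by
    have hne : (Nat.card G).primeFactors.Nonempty :=
      Nat.nonempty_primeFactors.2 Finite.one_lt_card
    refine ⟨(Nat.card G).primeFactors.max' hne, ?_, fun q hq hd => Finset.le_max' _ q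
      (Nat.mem_primeFactors.2 ⟨hq, hd, Nat.card_pos.ne'⟩)⟩
    · have := Nat.mem_primeFactors.1 (Finset.max'_mem _ hne)
      exact ⟨this.1, this.2.1⟩
  have := Fact.mk hp
  obtain ⟨P, hP⟩ := h.exists_normal_sylow hAB (hD A hA) (hD B hB) hp hmax
  have hPne : (P : Subgroup G) ≠ ⊥ := P.ne_bot_of_dvd_card hpd
  obtain ⟨hab, hexp, hmin, L, hPL, hPL'⟩ :=
    P.exists_complement_of_frattini_eq_bot hp hP hPne hfr hirr
  have hBA := mul_eq_univ_comm hAB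
  have : IsMulCommutative (P : Subgroup G) :=
    ⟨⟨fun x y => Subtype.ext (hab x x.2 y y.2)⟩⟩
  open scoped IsMulCommutative in
  let : Module (ZMod p) (Additive (P : Subgroup G)) := AddCommGroup.zmodModule fun x =>
    Additive.toMul.injective (Subtype.ext (hexp x.toMul x.toMul.2))
  -- if one of the factors contains `P`, the other one acts on `P` by scalars
  have key : ∀ C D : Subgroup G, MspPermutable C D → (C : Set G) * (D : Set G) = Set.univ →
      F D → ¬ (P : Subgroup G) ≤ D := by
    intro C D hCD hmul hDF hPD
    exact hG (hsat.of_scalar_factor hF hS hU hp hPL hPL' hPD hmul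
      (fun U hUP => hCD.symm.le_normalizer hp P hab (hUP.trans hPD) hUP) hDF (hquot P hPne))
  have hnorm : ∀ C D : Subgroup G, MspPermutable C D → (C : Set G) * (D : Set G) = Set.univ →
      ¬ (P : Subgroup G) ≤ C → ¬ p ∣ Nat.card C := by
    intro C D hCD hmul hPC hd
    have hn : (C ⊓ P).Normal := by
      rw [← normalizer_eq_top_iff, eq_top_iff']
      intro g
      obtain ⟨c, hc, d, hd, rfl⟩ : g ∈ (C : Set G) * (D : Set G) := hmul ▸ Set.mem_univ g
      refine mul_mem ?_ (hCD.le_normalizer hp P hab inf_le_left inf_le_right hd)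
      exact inf_normalizer_le_normalizer_inf
        ⟨Subgroup.le_normalizer hc, le_normalizer_of_normal (K := C) hc⟩
    rcases hmin _ hn inf_le_right with e | e
    · have h1 : (P : Subgroup G).relIndex C = Nat.card C := by
        rw [← inf_relIndex_right, inf_comm, e, relIndex_bot_left]
      exact P.not_dvd_index (hd.trans (h1 ▸ relIndex_dvd_index_of_normal (P : Subgroup G) C))
    · exact hPC (inf_eq_right.1 e)
  rcases dvd_card_or_dvd_card_of_mul_eq_univ hp hAB hpd with hd | hd
  · exact hnorm A B h hAB (key B A h.symm hBA hA) hd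
  · exact hnorm B A h.symm hBA (key A B h hAB hB) hd

theorem mainTheorem1 (F : FinGroupClass.{u})
    (hform : IsFormation F) (hsat : IsSaturated F) (hsub : IsSubgroupClosed F)
    (hU : ∀ (X : Type u) [Group X] [Finite X], IsSupersoluble X → F X)
    (hD : ∀ (X : Type u) [Group X] [Finite X], F X → HasOrderedSylowTower X)
    (G : Type u) [Group G] [Finite G] (G₁ G₂ : Subgroup G)
    (hmsp : MspPermutable G₁ G₂)
    (hG : (G₁ : Set G) * (G₂ : Set G) = Set.univ)
    (h₁ : F G₁) (h₂ : F G₂) :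
    F G := by
  induction hn : Nat.card G using Nat.strong_induction_on generalizing G with
  | _ n ih =>
    refine hmsp.mem_of_forall_quotient hform hsat hsub hU hD hG h₁ h₂ fun K _ hK => ?_
    refine ih (Nat.card (G ⧸ K)) ?_ (G ⧸ K) (G₁.map (QuotientGroup.mk' K))
      (G₂.map (QuotientGroup.mk' K)) (hmsp.map _) ?_
      (hform.of_surjective _ (MonoidHom.subgroupMap_surjective (QuotientGroup.mk' K) G₁) h₁)
      (hform.of_surjective _ (MonoidHom.subgroupMap_surjective (QuotientGroup.mk' K) G₂) h₂) rfl
    · rw [← hn, K.card_eq_card_quotient_mul_card_subgroup]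
      exact lt_mul_of_one_lt_right Nat.card_pos (K.one_lt_card_iff_ne_bot.2 hK)
    · rw [Subgroup.coe_map, Subgroup.coe_map, ← Set.image_mul, hG, Set.image_univ,
        (QuotientGroup.mk'_surjective K).range_eq]
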